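/- Let $\mu$ and $\nu$ be finite non-atomic Borel measures on a Polish space $X$, with $\nu\neq 0$, and suppose that $D(\mu\Vert\nu)=\infty$. Here $D(\mu\Vert\nu)=\int f\left(\frac{d\mu}{d\nu}\right)d\nu$ with $f(x)=x\ln x-(x-1)$ if $\mu\ll\nu$, and $D(\mu\Vert\nu)=\infty$ otherwise. Then there is an increasing sequence $\mathcal F_0\subseteq\mathcal F_1\subseteq\cdots$ of finite subalgebras of the Borel $\sigma$-algebra of $X$ such that for every $i$ the restriction $\mu_{|\mathcal F_i}$ is absolutely continuous with respect to $\nu_{|\mathcal F_i}$ and such that the densities $\rho_i=\frac{d\mu_{|\mathcal F_i}}{d\nu_{|\mathcal F_i}}$ satisfy $$\int_X \sup_{i}\rho_i\,d\nu=\infty .$$ -/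

import Mathlib

open MeasureTheory ProbabilityTheory InformationTheory
open scoped ENNReal

/-- The density of `μ` restricted to the sub-σ-algebra `m` with respect to `ν` restricted to `m`
(the Radon-Nikodym derivative of the restrictions, determined up to a `ν`-null set when the
restriction of `μ` is absolutely continuous with respect to that of `ν`). -/
noncomputable def subalgebraDensity {X : Type*} {m m0 : MeasurableSpace X}
    (μ ν : @Measure X m0) (hm : m ≤ m0) : X → ℝ≥0∞ :=
  (μ.trim hm).rnDeriv (ν.trim hm)

/-!
The divergence is infinite exactly when `μ` charges a `ν`-null set or the density `f = dμ/dν`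
fails to be in `L log L`. Either way there are decreasing sets `B i` with `ν (B i) ≤ 2⁻ⁱ ν X` and
`∑ μ (B i) = ∞` (`exists_antitone_measure_le_tsum_eq_top`). If `μ` is not absolutely continuous,
all `B i` equal a `ν`-null set charged by `μ`. Otherwise `B i = {f ≥ c 2ⁱ}`: the Markov
inequality bounds `ν (B i)`, and since the number of `i` with `x ∈ B i` is at least `log (f x / c)`,
the sum `∑ μ (B i) = ∫ f · #{i | x ∈ B i} dν` dominates `∫ f log f dν` up to finite terms.

As `ν` is non-atomic, the `B i` can be enlarged to decreasing sets `A i` of measure exactly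
`2⁻ⁱ ν X` (`exists_antitone_superset_measure_eq`). The algebra generated by `A 1, …, A n` has
the atoms `A k \ A (k + 1)` for `k < n` and `A n`, all of positive `ν`-measure, so absolute
continuity is automatic even if `μ` is singular. On the atom `A n` the density is
`μ (A n) / ν (A n)`, and half the mass of `A n` lies in `A n \ A (n + 1)`. Summing over these
disjoint differences, the integral of the maximal density is at least `½ ∑ μ (A n) = ∞`
(`lintegral_iSup_subalgebraDensity_setFiltration_eq_top`).
-/

/-! ### Intermediate values of a non-atomic measure -/

/-- The distribution function of a non-atomic finite measure on `ℝ` attains every value strictly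
between `0` and the total mass. -/
theorem exists_measure_Iic_eq (ρ : Measure ℝ) [IsFiniteMeasure ρ] [NullSingletonClass ρ]
    {r : ℝ≥0∞} (h0 : 0 < r) (h1 : r < ρ Set.univ) : ∃ t, ρ (Set.Iic t) = r := by
  have hcont : Continuous fun t ↦ ρ.real (Set.Iic t) := by
    have hone (t : ℝ) : ∫ _ in Set.Iic t, (1 : ℝ) ∂ρ = ρ.real (Set.Iic t) := by simp
    rw [continuous_iff_continuousAt]
    intro t
    have h := (integrable_const (μ := ρ) (1 : ℝ)).integrableOn (s := Set.Iic (t + 1))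
    have h' := (h.continuousOn_Iic_primitive_Iic).continuousAt (Iic_mem_nhds (lt_add_one t))
    simpa only [hone] using h'
  have hbot : Filter.Tendsto (fun t ↦ ρ (Set.Iic t)) Filter.atBot (nhds 0) := by
    have h := tendsto_measure_iInter_atBot (μ := ρ) (s := fun t : ℝ ↦ Set.Iic t)
      (fun t ↦ measurableSet_Iic.nullMeasurableSet) (fun _ _ hab ↦ Set.Iic_subset_Iic.2 hab)
      ⟨0, measure_ne_top _ _⟩
    have he : ⋂ t : ℝ, Set.Iic t = ∅ := by
      ext x
      simpa using exists_lt x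
    rw [he, measure_empty] at h
    exact h
  obtain ⟨a, ha⟩ := (hbot.eventually (gt_mem_nhds h0)).exists
  obtain ⟨b, hb⟩ := ((tendsto_measure_Iic_atTop ρ).eventually (lt_mem_nhds h1)).exists
  have hr : r ≠ ∞ := h1.ne_top
  obtain ⟨t, ht⟩ := mem_range_of_exists_le_of_exists_ge hcont (c := r.toReal)
    ⟨a, ENNReal.toReal_mono hr ha.le⟩ ⟨b, ENNReal.toReal_mono (measure_ne_top _ _) hb.le⟩
  exact ⟨t, (ENNReal.toReal_eq_toReal_iff' (measure_ne_top _ _) hr).1 ht⟩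

/-- A non-atomic finite measure on a standard Borel space takes every value between `ν S` and `ν T`
on the measurable sets between `S` and `T`. -/
theorem exists_measurableSet_between_measure_eq {X : Type*} [MeasurableSpace X]
    [StandardBorelSpace X] (ν : Measure X) [IsFiniteMeasure ν] [NullSingletonClass ν]
    {S T : Set X} (hS : MeasurableSet S) (hT : MeasurableSet T) (hST : S ⊆ T) {r : ℝ≥0∞}
    (hSr : ν S ≤ r) (hrT : r ≤ ν T) :
    ∃ A, MeasurableSet A ∧ S ⊆ A ∧ A ⊆ T ∧ ν A = r := by
  rcases hSr.eq_or_lt with rfl | hSr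
  · exact ⟨S, hS, subset_rfl, hST, rfl⟩
  rcases hrT.eq_or_lt with rfl | hrT
  · exact ⟨T, hT, hST, subset_rfl, rfl⟩
  have hφ := measurableEmbedding_embeddingReal X
  set φ := embeddingReal X
  let ρ := (ν.restrict (T \ S)).map φ
  have hρ : NullSingletonClass ρ := by
    refine ⟨fun t ↦ ?_⟩
    rw [hφ.map_apply]
    exact (Set.subsingleton_singleton.preimage hφ.injective).measure_zero _
  have hdiff : ν S + ν (T \ S) = ν T := measure_add_sdiff hS.nullMeasurableSet T ▸ by
    rw [Set.union_eq_self_of_subset_left hST]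
  obtain ⟨t, ht⟩ := exists_measure_Iic_eq ρ (r := r - ν S) (tsub_pos_of_lt hSr) (by
    rw [hφ.map_apply, Set.preimage_univ, Measure.restrict_apply_univ]
    rw [← hdiff] at hrT
    exact ENNReal.sub_lt_of_lt_add hSr.le (by rwa [add_comm]))
  have hm : MeasurableSet (φ ⁻¹' Set.Iic t) := hφ.measurable measurableSet_Iic
  rw [hφ.map_apply, Measure.restrict_apply hm] at ht
  refine ⟨S ∪ φ ⁻¹' Set.Iic t ∩ (T \ S), hS.union (hm.inter (hT.diff hS)),
    Set.subset_union_left, ?_, ?_⟩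
  · exact Set.union_subset hST fun x hx ↦ hx.2.1
  · rw [measure_union _ (hm.inter (hT.diff hS)), ht, add_tsub_cancel_of_le hSr.le]
    exact Set.disjoint_left.2 fun x hx hx' ↦ hx'.2.2 hx

/-- A decreasing sequence of measurable sets can be enlarged to a decreasing sequence of sets of
measure exactly `2⁻ⁱ ν X`, as soon as its measures do not exceed these values. -/
theorem exists_antitone_superset_measure_eq {X : Type*} [MeasurableSpace X]
    [StandardBorelSpace X] (ν : Measure X) [IsFiniteMeasure ν] [NullSingletonClass ν]
    {B : ℕ → Set X} (hBm : ∀ i, MeasurableSet (B i)) (hB : Antitone B)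
    (hνB : ∀ i, ν (B i) ≤ ν Set.univ * 2⁻¹ ^ i) :
    ∃ A : ℕ → Set X, (∀ i, MeasurableSet (A i)) ∧ Antitone A ∧ A 0 = Set.univ ∧
      (∀ i, B i ⊆ A i) ∧ ∀ i, ν (A i) = ν Set.univ * 2⁻¹ ^ i := by
  let P : ℕ → Set X → Prop := fun i A ↦
    MeasurableSet A ∧ B i ⊆ A ∧ ν A = ν Set.univ * 2⁻¹ ^ i
  have hstep : ∀ i A, P i A → ∃ A', A' ⊆ A ∧ P (i + 1) A' := by
    rintro i A ⟨hA, hBA, hνA⟩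
    obtain ⟨A', hA', hBA', hAA', hνA'⟩ := exists_measurableSet_between_measure_eq ν
      (hBm (i + 1)) hA ((hB i.le_succ).trans hBA) (hνB (i + 1)) (by
        rw [hνA, pow_succ]
        gcongr
        exact mul_le_of_le_one_right' (by simp))
    exact ⟨A', hAA', hA', hBA', hνA'⟩
  choose! g hgA hgP using hstep
  let A : ℕ → Set X := fun n ↦ Nat.rec Set.univ g n
  have hP : ∀ i, P i (A i) := by
    intro i
    induction i with
    | zero => exact ⟨MeasurableSet.univ, Set.subset_univ _, by simp [A]⟩
    | succ i ih => exact hgP i _ ih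
  exact ⟨A, fun i ↦ (hP i).1, antitone_nat_of_succ_le fun i ↦ hgA i _ (hP i), rfl,
    fun i ↦ (hP i).2.1, fun i ↦ (hP i).2.2⟩

/-! ### The filtration of a decreasing sequence of sets -/

/-- The membership pattern of a point with respect to `A 1, …, A n`. -/
def membershipPattern {X : Type*} (A : ℕ → Set X) (n : ℕ) (x : X) : Fin n → Prop :=
  fun i ↦ x ∈ A (i + 1)

theorem measurable_membershipPattern {X : Type*} [MeasurableSpace X] {A : ℕ → Set X}
    (hA : ∀ i, MeasurableSet (A i)) (n : ℕ) : Measurable (membershipPattern A n) :=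
  measurable_pi_lambda _ fun i ↦ measurable_mem.2 (hA (i + 1))

/-- The filtration whose `n`-th term is the algebra generated by `A 1, …, A n`, realized as the
pullback of the discrete σ-algebra under the membership pattern. -/
def setFiltration {X : Type*} [mX : MeasurableSpace X] (A : ℕ → Set X)
    (hA : ∀ i, MeasurableSet (A i)) : Filtration ℕ mX where
  seq n := MeasurableSpace.comap (membershipPattern A n) inferInstance
  mono' := by
    intro m n hmn
    have h : membershipPattern A m =
        (fun p : Fin n → Prop ↦ fun i : Fin m ↦ p (Fin.castLE hmn i)) ∘ membershipPattern A n := rfl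
    dsimp only
    rw [h, ← MeasurableSpace.comap_comp]
    exact MeasurableSpace.comap_mono
      (measurable_pi_lambda _ fun i ↦ measurable_pi_apply _).comap_le
  le' n := (measurable_membershipPattern hA n).comap_le

theorem finite_setFiltration {X : Type*} [MeasurableSpace X] {A : ℕ → Set X}
    (hA : ∀ i, MeasurableSet (A i)) (n : ℕ) :
    {s : Set X | MeasurableSet[setFiltration A hA n] s}.Finite := by
  refine (Set.finite_range fun S : Set (Fin n → Prop) ↦ membershipPattern A n ⁻¹' S).subset ?_
  rintro s ⟨S, -, rfl⟩
  exact ⟨S, rfl⟩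

/-- Points with the same membership pattern are not separated by the filtration. -/
theorem mem_of_membershipPattern_eq {X : Type*} [MeasurableSpace X] {A : ℕ → Set X}
    (hA : ∀ i, MeasurableSet (A i)) {n : ℕ} {s : Set X}
    (hs : MeasurableSet[setFiltration A hA n] s) {x y : X}
    (hxy : membershipPattern A n x = membershipPattern A n y) (hx : x ∈ s) : y ∈ s := by
  obtain ⟨S, -, rfl⟩ := hs
  rw [Set.mem_preimage] at hx ⊢
  rwa [← hxy]

theorem measurableSet_setFiltration {X : Type*} [MeasurableSpace X] {A : ℕ → Set X}
    (hA : ∀ i, MeasurableSet (A i)) (hA0 : A 0 = Set.univ) (n : ℕ) :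
    MeasurableSet[setFiltration A hA n] (A n) := by
  cases n with
  | zero => rw [hA0]; exact MeasurableSet.univ
  | succ n =>
    exact ⟨{p | p (Fin.last n)}, (Set.toFinite _).measurableSet, rfl⟩

/-- `A n` is an atom of the `n`-th algebra, since the sequence is decreasing. -/
theorem membershipPattern_eq_of_mem {X : Type*} {A : ℕ → Set X} (hanti : Antitone A) {n : ℕ}
    {x y : X} (hx : x ∈ A n) (hy : y ∈ A n) :
    membershipPattern A n x = membershipPattern A n y := by
  ext i
  have hi : (i : ℕ) + 1 ≤ n := i.2
  exact iff_of_true (hanti hi hx) (hanti hi hy)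

/-- Every nonempty set of the `n`-th algebra contains one of the differences `A k \ A (k + 1)`. -/
theorem exists_sdiff_subset {X : Type*} [MeasurableSpace X] {A : ℕ → Set X}
    (hA : ∀ i, MeasurableSet (A i)) (hanti : Antitone A) (hA0 : A 0 = Set.univ) {n : ℕ}
    {s : Set X} (hs : MeasurableSet[setFiltration A hA n] s) (hne : s.Nonempty) :
    ∃ k, A k \ A (k + 1) ⊆ s := by
  classical
  obtain ⟨x, hx⟩ := hne
  -- The last index `k ≤ n` with `x ∈ A k`.
  set k := Nat.findGreatest (fun k ↦ x ∈ A k) n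
  have hxk : x ∈ A k :=
    Nat.findGreatest_spec (P := fun k ↦ x ∈ A k) (Nat.zero_le n) (by simp [hA0])
  refine ⟨k, fun y hy ↦ mem_of_membershipPattern_eq hA hs ?_ hx⟩
  ext i
  have hi : (i : ℕ) + 1 ≤ n := i.2
  change x ∈ A (i + 1) ↔ y ∈ A (i + 1)
  by_cases hik : (i : ℕ) + 1 ≤ k
  · exact iff_of_true (hanti hik hxk) (hanti hik hy.1)
  · refine iff_of_false (Nat.findGreatest_is_greatest (not_le.1 hik) hi) fun h ↦ hy.2 ?_
    exact hanti (by omega) h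

/-- On `A n` the density of the `n`-th restrictions is the ratio of the measures of `A n`. -/
theorem subalgebraDensity_setFiltration_mul {X : Type*} [MeasurableSpace X] (μ ν : Measure X)
    [IsFiniteMeasure μ] [IsFiniteMeasure ν] {A : ℕ → Set X} (hA : ∀ i, MeasurableSet (A i))
    (hanti : Antitone A) (hA0 : A 0 = Set.univ) {n : ℕ}
    (hac : μ.trim ((setFiltration A hA).le n) ≪ ν.trim ((setFiltration A hA).le n))
    {x : X} (hx : x ∈ A n) :
    subalgebraDensity μ ν ((setFiltration A hA).le n) x * ν (A n) = μ (A n) := by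
  have hle := (setFiltration A hA).le n
  have hAn := measurableSet_setFiltration hA hA0 n
  have hρ : Measurable[setFiltration A hA n] (subalgebraDensity μ ν hle) :=
    Measure.measurable_rnDeriv _ _
  have hconst : ∀ y ∈ A n, subalgebraDensity μ ν hle y = subalgebraDensity μ ν hle x :=
    fun y hy ↦ mem_of_membershipPattern_eq hA (hρ (measurableSet_singleton _))
      (membershipPattern_eq_of_mem hanti hx hy) rfl
  calc subalgebraDensity μ ν hle x * ν (A n)
      = ∫⁻ y in A n, subalgebraDensity μ ν hle y ∂ν := by
        rw [setLIntegral_congr_fun (hA n) hconst, setLIntegral_const]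
    _ = ∫⁻ y in A n, subalgebraDensity μ ν hle y ∂ν.trim hle :=
        (setLIntegral_trim hle hρ hAn).symm
    _ = μ.trim hle (A n) := Measure.setLIntegral_rnDeriv hac _
    _ = μ (A n) := trim_measurableSet_eq hle hAn

/-- If the sets `A n` halve their `ν`-measure at each step and have a divergent sum of
`μ`-measures, then the maximal function of the densities is not integrable: on `A n \ A (n + 1)`,
which has half the mass of `A n`, it is at least `μ (A n) / ν (A n)`. -/
theorem lintegral_iSup_subalgebraDensity_setFiltration_eq_top {X : Type*} [MeasurableSpace X]
    (μ ν : Measure X) [IsFiniteMeasure μ] [IsFiniteMeasure ν] (hν : ν ≠ 0) {A : ℕ → Set X}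
    (hA : ∀ i, MeasurableSet (A i)) (hanti : Antitone A) (hA0 : A 0 = Set.univ)
    (hνA : ∀ i, ν (A i) = ν Set.univ * 2⁻¹ ^ i) (hμA : ∑' i, μ (A i) = ∞) :
    (∀ n, μ.trim ((setFiltration A hA).le n) ≪ ν.trim ((setFiltration A hA).le n)) ∧
      ∫⁻ x, ⨆ n, subalgebraDensity μ ν ((setFiltration A hA).le n) x ∂ν = ∞ := by
  have hhalf (i : ℕ) : ν (A (i + 1)) = ν (A i) * 2⁻¹ := by
    rw [hνA, hνA, pow_succ, mul_assoc]
  have hdiff (i : ℕ) : ν (A i \ A (i + 1)) = ν (A i) * 2⁻¹ := by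
    rw [measure_sdiff (hanti i.le_succ) (hA _).nullMeasurableSet (measure_ne_top _ _), hhalf]
    nth_rewrite 1 [← mul_one (ν (A i)), ← ENNReal.inv_two_add_inv_two, mul_add]
    exact ENNReal.add_sub_cancel_right (hhalf i ▸ measure_ne_top _ _)
  have hdiff0 (i : ℕ) : ν (A i \ A (i + 1)) ≠ 0 := by
    rw [hdiff, hνA]
    simp [hν]
  have hac (n : ℕ) :
      μ.trim ((setFiltration A hA).le n) ≪ ν.trim ((setFiltration A hA).le n) := by
    refine Measure.AbsolutelyContinuous.mk fun s hs h0 ↦ ?_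
    rw [trim_measurableSet_eq _ hs] at h0
    rcases s.eq_empty_or_nonempty with rfl | hne
    · exact measure_empty
    · obtain ⟨k, hk⟩ := exists_sdiff_subset hA hanti hA0 hs hne
      exact absurd (measure_mono_null hk h0) (hdiff0 k)
  refine ⟨hac, top_unique ?_⟩
  have hdisj : Pairwise (Function.onFun Disjoint fun i ↦ A i \ A (i + 1)) := by
    refine (symm_disjoint.comap _).pairwise_on _ |>.2 fun i j hij ↦ ?_
    exact Set.disjoint_left.2 fun x hx hx' ↦ hx.2 (hanti hij hx'.1)
  calc ∞ = ∑' i, μ (A i) * 2⁻¹ := by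
        rw [ENNReal.tsum_mul_right, hμA, ENNReal.top_mul (by simp)]
    _ ≤ ∑' i, ∫⁻ x in A i \ A (i + 1),
          ⨆ n, subalgebraDensity μ ν ((setFiltration A hA).le n) x ∂ν := by
        refine ENNReal.tsum_le_tsum fun i ↦ ?_
        calc μ (A i) * 2⁻¹ = ∫⁻ _ in A i \ A (i + 1), μ (A i) / ν (A i) ∂ν := by
              have h0 : ν (A i) ≠ 0 := fun h ↦ hdiff0 i (measure_mono_null Set.sdiff_subset h)
              rw [setLIntegral_const, hdiff, ← mul_assoc,
                ENNReal.div_mul_cancel h0 (measure_ne_top _ _)]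
          _ ≤ _ := by
              refine setLIntegral_mono' ((hA _).diff (hA _)) fun x hx ↦ ?_
              refine le_trans ?_ (le_iSup _ i)
              refine ENNReal.div_le_of_le_mul ?_
              exact (subalgebraDensity_setFiltration_mul μ ν hA hanti hA0 (hac i) hx.1).ge
    _ = ∫⁻ x in ⋃ i, A i \ A (i + 1),
          ⨆ n, subalgebraDensity μ ν ((setFiltration A hA).le n) x ∂ν :=
        (lintegral_iUnion (fun i ↦ (hA _).diff (hA _)) hdisj _).symm
    _ ≤ _ := setLIntegral_le_lintegral _ _

/-! ### Dyadic superlevel sets of the density -/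

/-- Up to the affine term `g * log c + 1`, the function `klFun` at `g` is at most `g` times the
number of dyadic levels `c * 2 ^ i` below `g`. -/
theorem exists_klFun_le_mul_add {c g : ℝ} (hc : 1 ≤ c) (hg : 0 ≤ g) :
    ∃ N : ℕ, (∀ i < N, c * 2 ^ i ≤ g) ∧ klFun g ≤ g * (Real.log c + N) + 1 := by
  have hc0 : 0 < c := by linarith
  have hmain {N : ℕ} (h : Real.log g ≤ Real.log c + N) :
      klFun g ≤ g * (Real.log c + N) + 1 := by
    rw [klFun_apply]
    linarith [mul_le_mul_of_nonneg_left h hg]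
  rcases hg.eq_or_lt with rfl | hg
  · exact ⟨0, by simp, by simp [klFun_apply]⟩
  rcases lt_or_ge g c with hgc | hcg
  · exact ⟨0, by simp, hmain (by simpa using Real.log_le_log hg hgc.le)⟩
  obtain ⟨k, hk, hk'⟩ := exists_nat_pow_near ((one_le_div hc0).2 hcg) one_lt_two
  rw [le_div_iff₀ hc0] at hk
  rw [div_lt_iff₀ hc0] at hk'
  refine ⟨k + 1, fun i hi ↦ ?_, hmain ?_⟩
  · calc c * 2 ^ i ≤ c * 2 ^ k := by
          gcongr
          · norm_num
          · omega
      _ ≤ g := by linarith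
  · calc Real.log g ≤ Real.log (2 ^ (k + 1) * c) := Real.log_le_log hg hk'.le
      _ = Real.log c + ((k + 1 : ℕ) : ℝ) * Real.log 2 := by
          rw [Real.log_mul (by positivity) hc0.ne', Real.log_pow]
          ring
      _ ≤ Real.log c + ((k + 1 : ℕ) : ℝ) * 1 := by
          gcongr
          linarith [Real.log_two_lt_d9]
      _ = Real.log c + ((k + 1 : ℕ) : ℝ) := by rw [mul_one]

/-- If `μ` is absolutely continuous and its divergence is infinite, then the `μ`-measures of the
dyadic superlevel sets of the density have a divergent sum. -/
theorem tsum_measure_superlevel_rnDeriv_eq_top {X : Type*} [MeasurableSpace X] (μ ν : Measure X)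
    [IsFiniteMeasure μ] [IsFiniteMeasure ν] (hac : μ ≪ ν) (hD : klDiv μ ν = ∞) {c : ℝ}
    (hc : 1 ≤ c) : ∑' i : ℕ, μ {x | ENNReal.ofReal (c * 2 ^ i) ≤ μ.rnDeriv ν x} = ∞ := by
  set f := μ.rnDeriv ν
  have hf : Measurable f := Measure.measurable_rnDeriv _ _
  set B : ℕ → Set X := fun i ↦ {x | ENNReal.ofReal (c * 2 ^ i) ≤ f x}
  have hB (i : ℕ) : MeasurableSet (B i) := measurableSet_le measurable_const hf
  by_contra hsum
  have hpt : ∀ᵐ x ∂ν, ENNReal.ofReal (klFun (f x).toReal) ≤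
      ENNReal.ofReal (Real.log c) * f x + ∑' i, (B i).indicator f x + 1 := by
    filter_upwards [Measure.rnDeriv_lt_top μ ν] with x hx
    obtain ⟨N, hN, hle⟩ := exists_klFun_le_mul_add hc (ENNReal.toReal_nonneg (a := f x))
    have hcount : N * f x ≤ ∑' i, (B i).indicator f x := by
      calc N * f x = ∑ i ∈ Finset.range N, (B i).indicator f x := by
            rw [Finset.sum_congr rfl (g := fun _ ↦ f x), Finset.sum_const, Finset.card_range,
              nsmul_eq_mul]
            intro i hi
            refine Set.indicator_of_mem ?_ _
            exact ENNReal.ofReal_le_of_le_toReal (hN i (Finset.mem_range.1 hi))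
        _ ≤ _ := ENNReal.sum_le_tsum _
    calc ENNReal.ofReal (klFun (f x).toReal)
        ≤ ENNReal.ofReal ((f x).toReal * (Real.log c + N) + 1) := ENNReal.ofReal_le_ofReal hle
      _ = ENNReal.ofReal (Real.log c) * f x + N * f x + 1 := by
          have hlog : 0 ≤ Real.log c := Real.log_nonneg hc
          rw [ENNReal.ofReal_add (by positivity) zero_le_one, ENNReal.ofReal_mul (by positivity),
            ENNReal.ofReal_add hlog (by positivity), ENNReal.ofReal_toReal hx.ne,
            ENNReal.ofReal_natCast, ENNReal.ofReal_one]
          ring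
      _ ≤ _ := by gcongr
  have hbound : klDiv μ ν ≤
      ENNReal.ofReal (Real.log c) * μ Set.univ + ∑' i, μ (B i) + ν Set.univ := by
    rw [klDiv_eq_lintegral_klFun_of_ac hac]
    refine (lintegral_mono_ae hpt).trans ?_
    rw [lintegral_add_right _ measurable_const, lintegral_add_left (hf.const_mul _),
      lintegral_const_mul _ hf, lintegral_tsum fun i ↦ (hf.indicator (hB i)).aemeasurable,
      lintegral_one]
    gcongr with i
    · exact Measure.lintegral_rnDeriv_le
    · rw [lintegral_indicator (hB i)]
      exact Measure.setLIntegral_rnDeriv_le _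
  rw [hD, top_le_iff] at hbound
  exact (ENNReal.add_lt_top.2 ⟨ENNReal.add_lt_top.2 ⟨ENNReal.mul_lt_top ENNReal.ofReal_lt_top
    (measure_lt_top _ _), lt_top_iff_ne_top.2 hsum⟩, measure_lt_top _ _⟩).ne hbound

/-- Infinite divergence yields a decreasing sequence of sets whose `ν`-measures decay at least
dyadically although their `μ`-measures have a divergent sum. -/
theorem exists_antitone_measure_le_tsum_eq_top {X : Type*} [MeasurableSpace X] (μ ν : Measure X)
    [IsFiniteMeasure μ] [IsFiniteMeasure ν] (hν : ν ≠ 0) (hD : klDiv μ ν = ∞) :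
    ∃ B : ℕ → Set X, (∀ i, MeasurableSet (B i)) ∧ Antitone B ∧
      (∀ i, ν (B i) ≤ ν Set.univ * 2⁻¹ ^ i) ∧ ∑' i, μ (B i) = ∞ := by
  by_cases hac : μ ≪ ν
  · -- With this `c`, the Markov inequality bounds `ν (B i)` by `μ X / (c * 2 ^ i) ≤ ν X / 2 ^ i`.
    let c : ℝ := μ.real Set.univ / ν.real Set.univ + 1
    have hν0 : 0 < ν.real Set.univ := by
      rw [measureReal_def]
      exact ENNReal.toReal_pos (by simpa using hν) (measure_ne_top _ _)
    have hc : 1 ≤ c := le_add_of_nonneg_left (by positivity)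
    have hc0 : 0 < c := by linarith
    have hμc : μ Set.univ ≤ ENNReal.ofReal c * ν Set.univ := by
      rw [← ofReal_measureReal (μ := μ), ← ofReal_measureReal (μ := ν),
        ← ENNReal.ofReal_mul hc0.le]
      refine ENNReal.ofReal_le_ofReal ?_
      rw [add_mul, div_mul_cancel₀ _ hν0.ne']
      linarith
    refine ⟨fun i ↦ {x | ENNReal.ofReal (c * 2 ^ i) ≤ μ.rnDeriv ν x},
      fun i ↦ measurableSet_le measurable_const (Measure.measurable_rnDeriv _ _),
      fun i j hij x hx ↦ le_trans (ENNReal.ofReal_le_ofReal ?_) hx, fun i ↦ ?_,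
      tsum_measure_superlevel_rnDeriv_eq_top μ ν hac hD hc⟩
    · gcongr
      norm_num
    · have hmarkov := (mul_meas_ge_le_lintegral (μ := ν) (Measure.measurable_rnDeriv μ ν)
        (ENNReal.ofReal (c * 2 ^ i))).trans (Measure.lintegral_rnDeriv_le.trans hμc)
      have hsplit : ENNReal.ofReal (c * 2 ^ i) = ENNReal.ofReal c * 2 ^ i := by
        rw [ENNReal.ofReal_mul hc0.le, ENNReal.ofReal_pow zero_le_two, ENNReal.ofReal_ofNat]
      rw [hsplit, mul_assoc, ENNReal.mul_le_mul_iff_right (by simpa using hc0)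
        ENNReal.ofReal_ne_top] at hmarkov
      rw [← ENNReal.inv_pow, ← div_eq_mul_inv, ENNReal.le_div_iff_mul_le (by simp) (by simp),
        mul_comm]
      simpa only [hsplit] using hmarkov
  · obtain ⟨N, hN, hνN, hμN⟩ : ∃ N, MeasurableSet N ∧ ν N = 0 ∧ μ N ≠ 0 := by
      by_contra! h
      exact hac (Measure.AbsolutelyContinuous.mk fun s hs h0 ↦ h s hs h0)
    exact ⟨fun _ ↦ N, fun _ ↦ hN, antitone_const, by simp [hνN],
      ENNReal.tsum_const_eq_top_of_ne_zero hμN⟩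

/-! ### Non-integrability of the maximal density -/

theorem mainTheorem5 {X : Type*} [TopologicalSpace X] [PolishSpace X]
    [mX : MeasurableSpace X] [BorelSpace X]
    (μ ν : Measure X) [IsFiniteMeasure μ] [IsFiniteMeasure ν] 
    [NullSingletonClass μ] [NullSingletonClass ν]
    (hν : ν ≠ 0) (hD : klDiv μ ν = ∞) :
    ∃ F : Filtration ℕ mX,
      (∀ n, {s : Set X | MeasurableSet[F n] s}.Finite) ∧
      (∀ n, μ.trim (F.le n) ≪ ν.trim (F.le n)) ∧
      ∫⁻ x, ⨆ n, subalgebraDensity μ ν (F.le n) x ∂ν = ∞ := by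
  obtain ⟨B, hBm, hB, hνB, hμB⟩ := exists_antitone_measure_le_tsum_eq_top μ ν hν hD
  obtain ⟨A, hA, hanti, hA0, hBA, hνA⟩ := exists_antitone_superset_measure_eq ν hBm hB hνB
  have hμA : ∑' i, μ (A i) = ∞ :=
    top_unique (hμB ▸ ENNReal.tsum_le_tsum fun i ↦ measure_mono (hBA i))
  exact ⟨setFiltration A hA, finite_setFiltration hA,
    lintegral_iSup_subalgebraDensity_setFiltration_eq_top μ ν hν hA hanti hA0 hνA hμA⟩
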